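/- A set $N$ is an $\epsilon$-net, with respect to a family $\mathcal S$ of subsets of the plane, of a finite point set $P\subset\mathbb R^2$ if $N\subseteq P$ and $N\cap S\neq\emptyset$ for every $S\in\mathcal S$ with $|S\cap P|>\epsilon|P|$. Let $\epsilon_i^{\mathcal S}$ be the smallest $\epsilon\in[0,1]$ such that every finite set $P\subset\mathbb R^2$ with at least $i$ points has an $\epsilon$-net of size $i$ with respect to $\mathcal S$. Let $\mathcal D$ be the family of disks in the plane. A centerpoint of $P$ is a point $p\in\mathbb R^2$ such that every closed halfplane containing $p$ contains at least $|P|/3$ points of $P$. A Delaunay triangle of $P$ is a nondegenerate triangle with vertices in $P$ whose circumcircle has no point of $P$ in its interior. **Theorem.** $\epsilon_2^{\mathcal D}\le \frac23$. Moreover, let $P$ be a finite set of $n$ points in the plane, not all on one line. Then $P$ has a centerpoint, every centerpoint of $P$ lies in some (closed) Delaunay triangle of $P$, and for every centerpoint $p$ of $P$ and every Delaunay triangle $abc$ of $P$ that contains $p$: 1. one of the three edges of $abc$ is met by at least $\frac{n-3}{3}$ of the $n-3$ segments $pq$, $q\in P\setminus\{a,b,c\}$; 2. the two endpoints of any edge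 of $abc$ that is met by at least $\frac{n-3}{3}$ of these segments form a $\frac23$-net of $P$ with respect to $\mathcal D$. -/

import Mathlib

/-- `N` is a (strong) `ε`-net of the finite point set `P` with respect to the family `𝓡`:
`N ⊆ P`, and `N` meets every member of `𝓡` that has more than `ε * |P|` points of `P`. -/
def IsStrongNet {α : Type*} (ε : ℝ) (P : Finset α) (𝓡 : Set (Set α)) (N : Set α) : Prop :=
  N ⊆ (P : Set α) ∧
    ∀ R ∈ 𝓡, ε * (P.card : ℝ) < ((R ∩ (P : Set α)).ncard : ℝ) → (N ∩ R).Nonempty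

/-- The set of all `ε ∈ [0, 1]` such that every finite point set (with at least `i` points, so that
it has subsets of size `i` at all) has an `ε`-net of size `i` with respect to `𝓢`. -/
def netBounds {α : Type*} (𝓢 : Set (Set α)) (i : ℕ) : Set ℝ :=
  {ε | ε ∈ Set.Icc (0 : ℝ) 1 ∧ ∀ P : Finset α, i ≤ P.card →
    ∃ Q : Finset α, Q ⊆ P ∧ Q.card = i ∧ IsStrongNet ε P 𝓢 (Q : Set α)}

/-- The constant `ε_i^𝓢`: the smallest element of `netBounds 𝓢 i`
(it exists by `isLeast_epsilonConst`). -/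
noncomputable def epsilonConst {α : Type*} (𝓢 : Set (Set α)) (i : ℕ) : ℝ :=
  sInf (netBounds 𝓢 i)

/-- `epsilonConst 𝓢 i` is the minimum of `netBounds 𝓢 i`, not a junk value. -/
theorem isLeast_epsilonConst {α : Type*} (𝓢 : Set (Set α)) (i : ℕ) :
    IsLeast (netBounds 𝓢 i) (epsilonConst 𝓢 i) := by
  have hbdd : BddBelow (netBounds 𝓢 i) := ⟨0, fun ε hε => hε.1.1⟩
  have hone : (1 : ℝ) ∈ netBounds 𝓢 i := by
    refine ⟨by simp, fun P hP => ?_⟩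
    obtain ⟨Q, hQ, hc⟩ := Finset.exists_subset_card_eq hP
    refine ⟨Q, hQ, hc, by exact_mod_cast hQ, fun R _ h => ?_⟩
    have h1 : (R ∩ (P : Set α)).ncard ≤ (P : Set α).ncard :=
      Set.ncard_le_ncard Set.inter_subset_right P.finite_toSet
    rw [Set.ncard_coe_finset] at h1
    have h2 : ((R ∩ (P : Set α)).ncard : ℝ) ≤ P.card := by exact_mod_cast h1
    linarith
  have hne : (netBounds 𝓢 i).Nonempty := ⟨1, hone⟩
  have h0 : 0 ≤ epsilonConst 𝓢 i := le_csInf hne fun ε hε => hε.1.1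
  refine ⟨⟨⟨h0, csInf_le hbdd hone⟩, fun P hP => ?_⟩, fun ε hε => csInf_le hbdd hε⟩
  set e := epsilonConst 𝓢 i with he
  have key : ∃ ε' ∈ netBounds 𝓢 i, ε' * (P.card : ℝ) < (⌊e * (P.card : ℝ)⌋₊ : ℝ) + 1 := by
    rcases Nat.eq_zero_or_pos P.card with h | h
    · exact ⟨1, hone, by simp [h]⟩
    · have hp : (0 : ℝ) < P.card := by exact_mod_cast h
      have hlt : sInf (netBounds 𝓢 i) < ((⌊e * (P.card : ℝ)⌋₊ : ℝ) + 1) / P.card := by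
        rw [lt_div_iff₀ hp]
        exact Nat.lt_floor_add_one (e * (P.card : ℝ))
      obtain ⟨ε', h1, h2⟩ := exists_lt_of_csInf_lt hne hlt
      exact ⟨ε', h1, (lt_div_iff₀ hp).1 h2⟩
  obtain ⟨ε', h1, h2⟩ := key
  obtain ⟨Q, hQ, hc, hs, hnet⟩ := h1.2 P hP
  refine ⟨Q, hQ, hc, hs, fun R hR h => hnet R hR (h2.trans_le ?_)⟩
  have h3 : ⌊e * (P.card : ℝ)⌋₊ < (R ∩ (P : Set α)).ncard :=
    (Nat.floor_lt (mul_nonneg h0 (Nat.cast_nonneg _))).2 h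
  exact_mod_cast h3

/-- The Euclidean plane. -/
abbrev Plane : Type := EuclideanSpace ℝ (Fin 2)

/-- The family of (closed, nondegenerate) disks in the plane. -/
def disks : Set (Set Plane) :=
  {D | ∃ (o : Plane) (r : ℝ), 0 < r ∧ D = Metric.closedBall o r}

/-- `x` is a centerpoint of `P ⊆ ℝ^d`: every halfspace `{y | t ≤ ⟪v, y⟫}` (with `v ≠ 0`) that
contains `x` contains at least `|P| / (d + 1)` points of `P`. -/
def IsCenterpoint {d : ℕ} (P : Finset (EuclideanSpace ℝ (Fin d)))
    (x : EuclideanSpace ℝ (Fin d)) : Prop :=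
  ∀ (v : EuclideanSpace ℝ (Fin d)) (t : ℝ), v ≠ 0 → t ≤ inner ℝ v x →
    (P.card : ℝ) / ((d : ℝ) + 1) ≤ (({y | t ≤ inner ℝ v y} ∩ (P : Set _)).ncard : ℝ)

/-- `T` is a Delaunay triangle of `P`: a nondegenerate triangle with vertices in `P` whose
circumcircle has no point of `P` in its interior. -/
def IsDelaunayTriangle (P : Finset Plane) (T : Affine.Triangle ℝ Plane) : Prop :=
  (∀ k, T.points k ∈ P) ∧ ∀ q ∈ P, T.circumradius ≤ dist q T.circumcenter

/-- The points `q` of `P`, other than the vertices of `T`, for which the segment `pq` meets the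
edge of `T` that joins the vertices number `i` and `j`. -/
def crossingPoints (P : Finset Plane) (T : Affine.Triangle ℝ Plane) (p : Plane)
    (i j : Fin 3) : Set Plane :=
  {q | q ∈ P ∧ q ∉ Set.range T.points ∧
    (segment ℝ p q ∩ segment ℝ (T.points i) (T.points j)).Nonempty}

/-!
A centerpoint `p` of `P` lies in `convexHull ℝ P`, by separation. Delaunay simplices cover this
hull: for `x` on no proper affine span of points of `P`, take a simplex `T ∋ x` with vertices in
`P` that maximizes the power of `x` with respect to the circumsphere. If `q ∈ P` were inside that
sphere, one could exchange a vertex of `T` for `q` and still contain `x`; on the new simplex the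
difference of the two powers is an affine function that is nonnegative at the vertices and
positive at `q`, so the power of `x` would have grown. Density of such `x` and closedness of the
simplices give the rest.

A segment from a point `p` of a Delaunay triangle to a point of `P` leaves the triangle through an
edge, so by pigeonhole one edge `ab` meets a third of the segments. Let `D` be a disk that contains
neither `a` nor `b`. If `D` contains no `q` whose segment `pq` crosses `ab`, it misses all these `q`
together with `a` and `b`. Otherwise the radical axis of `D` and the circumcircle has `p` on one
side and all of `P ∩ D` on the other, and the halfplane of `p` contains a third of `P`. If `P` is
collinear, a median point of `P` is already a `1/2`-net for all convex sets.
-/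

section Counting

variable {α : Type*}

theorem exists_mem_forall_mem_of_mul_card_sdiff_lt [DecidableEq α] {P : Finset α}
    (hP : P.Nonempty) {I : Finset (Finset α)} {k : ℕ} (hI : I.card ≤ k)
    (hlt : ∀ S ∈ I, k * (P \ S).card < P.card) : ∃ x ∈ P, ∀ S ∈ I, x ∈ S := by
  have hcard : (I.biUnion fun S => P \ S).card < P.card := by
    rcases I.eq_empty_or_nonempty with rfl | hIne
    · simpa using hP
    refine lt_of_mul_lt_mul_left (a := k) ?_ (Nat.zero_le _)
    calc k * (I.biUnion fun S => P \ S).card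
        ≤ k * ∑ S ∈ I, (P \ S).card := Nat.mul_le_mul_left _ Finset.card_biUnion_le
      _ = ∑ S ∈ I, k * (P \ S).card := Finset.mul_sum ..
      _ < ∑ _S ∈ I, P.card := Finset.sum_lt_sum_of_nonempty hIne hlt
      _ = I.card * P.card := Finset.sum_const_nat fun _ _ => rfl
      _ ≤ k * P.card := Nat.mul_le_mul_right _ hI
  obtain ⟨x, hxP, hx⟩ := Finset.exists_mem_notMem_of_card_lt_card hcard
  refine ⟨x, hxP, fun S hS => ?_⟩
  by_contra hxS
  exact hx (Finset.mem_biUnion.2 ⟨S, hS, Finset.mem_sdiff.2 ⟨hxP, hxS⟩⟩)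

theorem ncard_add_ncard_inter_le {P : Finset α} {A B : Set α} (hA : A ⊆ P)
    (hAB : Disjoint A B) : A.ncard + (B ∩ P).ncard ≤ P.card := by
  have hB : B ∩ P ⊆ (P : Set α) := Set.inter_subset_right
  rw [← Set.ncard_union_eq (hAB.mono_right Set.inter_subset_left) (P.finite_toSet.subset hA)
    (P.finite_toSet.subset hB), ← Set.ncard_coe_finset P]
  exact Set.ncard_le_ncard (Set.union_subset hA hB) P.finite_toSet

end Counting

section Centerpoint

theorem exists_mem_convexHull_of_mul_card_sdiff_lt {𝕜 E : Type*} [Field 𝕜] [LinearOrder 𝕜]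
    [IsStrictOrderedRing 𝕜] [AddCommGroup E] [Module 𝕜 E] [FiniteDimensional 𝕜 E]
    [DecidableEq E] {P : Finset E} (hP : P.Nonempty) :
    ∃ x, ∀ S ⊆ P, (Module.finrank 𝕜 E + 1) * (P \ S).card < P.card →
      x ∈ convexHull 𝕜 (S : Set E) := by
  let F : Finset (Finset E) :=
    P.powerset.filter fun S => (Module.finrank 𝕜 E + 1) * (P \ S).card < P.card
  have hne : (⋂ S ∈ F, convexHull 𝕜 (S : Set E)).Nonempty := by
    refine Convex.helly_theorem' (𝕜 := 𝕜) (fun _ _ => convex_convexHull 𝕜 _)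
      fun I hI hcard => ?_
    obtain ⟨x, -, hx⟩ := exists_mem_forall_mem_of_mul_card_sdiff_lt hP hcard
      fun S hS => (Finset.mem_filter.1 (hI hS)).2
    exact ⟨x, Set.mem_iInter₂.2 fun S hS => subset_convexHull 𝕜 _ (hx S hS)⟩
  obtain ⟨x, hx⟩ := hne
  exact ⟨x, fun S hS hlt => Set.mem_iInter₂.1 hx S
    (Finset.mem_filter.2 ⟨Finset.mem_powerset.2 hS, hlt⟩)⟩

variable {d : ℕ} {P : Finset (EuclideanSpace ℝ (Fin d))} {p : EuclideanSpace ℝ (Fin d)}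

theorem exists_isCenterpoint (hP : P.Nonempty) : ∃ p, IsCenterpoint P p := by
  classical
  obtain ⟨p, hp⟩ := exists_mem_convexHull_of_mul_card_sdiff_lt (𝕜 := ℝ) hP
  refine ⟨p, fun v t _ ht => ?_⟩
  by_contra! hlt
  set H := P.filter fun y => t ≤ inner ℝ v y with hH
  have hcoe : {y | t ≤ inner ℝ v y} ∩ (P : Set (EuclideanSpace ℝ (Fin d))) = H := by
    rw [hH, Finset.coe_filter, Set.inter_comm]
    rfl
  rw [hcoe, Set.ncard_coe_finset, lt_div_iff₀ (by positivity)] at hlt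
  have hmem : p ∈ convexHull ℝ ((P \ H : Finset _) : Set (EuclideanSpace ℝ (Fin d))) := by
    refine hp _ Finset.sdiff_subset ?_
    rw [Finset.sdiff_sdiff_eq_self (Finset.filter_subset _ _), finrank_euclideanSpace_fin,
      mul_comm]
    exact_mod_cast hlt
  have hsub : ((P \ H : Finset _) : Set (EuclideanSpace ℝ (Fin d))) ⊆
      {y | inner ℝ v y < t} := fun y hy => by
    obtain ⟨hyP, hyH⟩ := Finset.mem_sdiff.1 hy
    exact not_le.1 fun h => hyH (Finset.mem_filter.2 ⟨hyP, h⟩)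
  exact not_lt.2 ht (convexHull_min hsub (convex_halfSpace_lt (innerₛₗ ℝ v).isLinear t) hmem)

theorem IsCenterpoint.ncard_inter_add_le (hp : IsCenterpoint P p)
    {B : Set (EuclideanSpace ℝ (Fin d))} {v : EuclideanSpace ℝ (Fin d)}
    (hB : ∀ z ∈ P, z ∈ B → inner ℝ v z < inner ℝ v p) :
    ((B ∩ P).ncard : ℝ) + (P.card : ℝ) / (d + 1) ≤ P.card := by
  rcases eq_or_ne v 0 with rfl | hv
  · have hempty : B ∩ P = ∅ := Set.eq_empty_of_forall_notMem fun z hz => by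
      simpa using hB z hz.2 hz.1
    rw [hempty, Set.ncard_empty, Nat.cast_zero, zero_add]
    exact div_le_self (Nat.cast_nonneg _) (le_add_of_nonneg_left (Nat.cast_nonneg _))
  · have hdisj : Disjoint ({y | inner ℝ v p ≤ inner ℝ v y} ∩ (P : Set _)) B :=
      Set.disjoint_left.2 fun z hz hzB => not_lt.2 hz.1 (hB z hz.2 hzB)
    have hcount := ncard_add_ncard_inter_le Set.inter_subset_right hdisj
    have hhalf := hp v _ hv le_rfl
    have : ((({y | inner ℝ v p ≤ inner ℝ v y} ∩ (P : Set _)).ncard : ℝ) +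
      (B ∩ (P : Set _)).ncard) ≤ P.card := mod_cast hcount
    linarith

theorem IsCenterpoint.mem_convexHull (hp : IsCenterpoint P p) (hP : P.Nonempty) :
    p ∈ convexHull ℝ (P : Set (EuclideanSpace ℝ (Fin d))) := by
  by_contra hnot
  obtain ⟨f, u, hf, hu⟩ := geometric_hahn_banach_closed_point (convex_convexHull ℝ _)
    (P.finite_toSet.isClosed_convexHull ℝ) hnot
  obtain ⟨v, rfl⟩ := (InnerProductSpace.toDual ℝ (EuclideanSpace ℝ (Fin d))).surjective f
  simp only [InnerProductSpace.toDual_apply_apply] at hf hu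
  have hcount := hp.ncard_inter_add_le (B := Set.univ) (v := v) fun z hz _ =>
    (hf z (subset_convexHull ℝ _ hz)).trans hu
  rw [Set.univ_inter, Set.ncard_coe_finset] at hcount
  have : (0 : ℝ) < P.card / ((d : ℝ) + 1) :=
    div_pos (mod_cast hP.card_pos) (by positivity)
  linarith

end Centerpoint

section Simplex

variable {n : ℕ}

theorem isOpen_simplex_interior {E : Type*} [NormedAddCommGroup E] [NormedSpace ℝ E]
    [FiniteDimensional ℝ E] (hn : Module.finrank ℝ E = n) (T : Affine.Simplex ℝ E n) :
    IsOpen T.interior := by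
  let b : AffineBasis (Fin (n + 1)) ℝ E := ⟨T.points, T.independent, by
    rw [T.independent.affineSpan_eq_top_iff_card_eq_finrank_add_one, hn, Fintype.card_fin]⟩
  have hinterior : T.interior = ⋂ i, b.coord i ⁻¹' Set.Ioo 0 1 := by
    ext x
    rw [Set.mem_iInter, ← b.affineCombination_coord_eq_self x]
    exact (Affine.Simplex.affineCombination_mem_interior_iff (s := T)
      (b.sum_coord_apply_eq_one x)).trans (by simp only [b.affineCombination_coord_eq_self]; rfl)
  rw [hinterior]
  exact isOpen_iInter_of_finite fun i =>
    isOpen_Ioo.preimage (continuous_barycentric_coord b i)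

theorem exists_segment_inter_faceOpposite_nonempty {E : Type*} [NormedAddCommGroup E]
    [NormedSpace ℝ E] [FiniteDimensional ℝ E] [NeZero n] (hn : Module.finrank ℝ E = n)
    {T : Affine.Simplex ℝ E n} {p q : E} (hp : p ∈ T.closedInterior) (hq : q ∉ T.interior) :
    ∃ i, (segment ℝ p q ∩ (T.faceOpposite i).closedInterior).Nonempty := by
  by_contra! hempty
  have hoff : ∀ x ∈ segment ℝ p q, x ∈ T.closedInterior → x ∈ T.interior := fun x hx hxT => by
    rw [T.closedInterior_eq_interior_union] at hxT
    refine hxT.resolve_right fun hface => ?_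
    obtain ⟨i, hi⟩ := Set.mem_iUnion.1 hface
    exact (hempty i).subset ⟨hx, hi⟩
  have hsub : segment ℝ p q ⊆ T.interior :=
    (convex_segment p q).isPreconnected.subset_left_of_subset_union
      (isOpen_simplex_interior hn T) T.isClosed_closedInterior.isOpen_compl
      (Set.disjoint_left.2 fun _ hx hx' => hx' (T.interior_subset_closedInterior hx))
      (fun x hx => (em (x ∈ T.closedInterior)).imp (hoff x hx) id)
      ⟨p, left_mem_segment ℝ p q, hoff p (left_mem_segment ℝ p q) hp⟩
  exact hq (hsub (right_mem_segment ℝ p q))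

theorem pos_of_mem_simplex_interior {𝕜 E : Type*} [Field 𝕜] [LinearOrder 𝕜]
    [IsStrictOrderedRing 𝕜] [AddCommGroup E] [Module 𝕜 E] {T : Affine.Simplex 𝕜 E n} {x : E}
    (hx : x ∈ T.interior) {f : E →ᵃ[𝕜] 𝕜} (hnonneg : ∀ j, 0 ≤ f (T.points j)) {i : Fin (n + 1)}
    (hpos : 0 < f (T.points i)) : 0 < f x := by
  obtain ⟨w, hw, hw01, rfl⟩ := hx
  rw [Finset.map_affineCombination _ _ _ hw,
    Finset.affineCombination_eq_linear_combination _ _ _ hw]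
  exact Finset.sum_pos' (fun j _ => mul_nonneg (hw01 j).1.le (hnonneg j))
    ⟨i, Finset.mem_univ _, mul_pos (hw01 i).1 hpos⟩

theorem finite_setOf_simplex_points_mem {𝕜 E : Type*} [Ring 𝕜] [AddCommGroup E] [Module 𝕜 E]
    {P : Set E} (hP : P.Finite) : {T : Affine.Simplex 𝕜 E n | ∀ k, T.points k ∈ P}.Finite :=
  Set.Finite.of_finite_image ((Set.Finite.pi' fun _ : Fin (n + 1) => hP).subset
    (Set.image_subset_iff.2 fun _ hT => hT)) fun _ _ _ _ h => Affine.Simplex.ext (congrFun h)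

theorem convexHull_range_eq_image_stdSimplex {𝕜 E ι : Type*} [Field 𝕜] [LinearOrder 𝕜]
    [IsStrictOrderedRing 𝕜] [AddCommGroup E] [Module 𝕜 E] [Fintype ι] (t : ι → E) :
    convexHull 𝕜 (Set.range t) = Fintype.linearCombination 𝕜 t '' stdSimplex 𝕜 ι := by
  classical
  rw [← convexHull_rangle_single_eq_stdSimplex, LinearMap.image_convexHull, ← Set.range_comp]
  congr
  ext i
  simp

theorem sum_update_of_eq_zero {ι M : Type*} [AddCommMonoid M] [Fintype ι] [DecidableEq ι]
    {f : ι → M} {i : ι} (hi : f i = 0) (a : M) :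
    ∑ j, Function.update f i a j = a + ∑ j, f j := by
  rw [Finset.sum_update_of_mem (Finset.mem_univ i), ← Finset.add_sum_erase _ f (Finset.mem_univ i),
    hi, zero_add, Finset.sdiff_singleton_eq_erase]

-- The ratio test of the simplex method.
theorem exists_pivot {𝕜 ι : Type*} [Field 𝕜] [LinearOrder 𝕜] [IsStrictOrderedRing 𝕜] [Fintype ι]
    {l m : ι → 𝕜} (hl : ∀ i, 0 ≤ l i) (hm : 0 < ∑ i, m i) :
    ∃ s, 0 ≤ s ∧ ∃ i, l i - s * m i = 0 ∧ ∀ j, 0 ≤ l j - s * m j := by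
  obtain ⟨i₀, -, hi₀⟩ : ∃ i ∈ Finset.univ, 0 < m i :=
    Finset.exists_lt_of_sum_lt (f := fun _ => 0) (by rwa [Finset.sum_const_zero])
  obtain ⟨i, hi, hmin⟩ := Finset.exists_min_image (Finset.univ.filter fun i => 0 < m i)
    (fun i => l i / m i) ⟨i₀, by simpa using hi₀⟩
  simp only [Finset.mem_filter_univ] at hi hmin
  have hs : 0 ≤ l i / m i := div_nonneg (hl i) hi.le
  refine ⟨l i / m i, hs, i, by rw [div_mul_cancel₀ _ hi.ne', sub_self], fun j => ?_⟩
  rcases le_or_gt (m j) 0 with hj | hj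
  · linarith [hl j, mul_nonpos_of_nonneg_of_nonpos hs hj]
  · exact sub_nonneg.2 ((le_div_iff₀ hj).1 (hmin j hj))

theorem exists_mem_convexHull_range_update {𝕜 E ι : Type*} [Field 𝕜] [LinearOrder 𝕜]
    [IsStrictOrderedRing 𝕜] [AddCommGroup E] [Module 𝕜 E] [Finite ι] [DecidableEq ι] {t : ι → E}
    {x q : E} (hx : x ∈ convexHull 𝕜 (Set.range t)) (hq : q ∈ affineSpan 𝕜 (Set.range t)) :
    ∃ i, x ∈ convexHull 𝕜 (Set.range (Function.update t i q)) := by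
  have := Fintype.ofFinite ι
  rw [convexHull_range_eq_image_stdSimplex] at hx
  obtain ⟨l, ⟨hl, hl1⟩, rfl⟩ := hx
  obtain ⟨m, hm, rfl⟩ := eq_affineCombination_of_mem_affineSpan_of_fintype hq
  obtain ⟨s, hs, i, hi, hnonneg⟩ := exists_pivot hl (hm ▸ one_pos)
  refine ⟨i, ?_⟩
  rw [convexHull_range_eq_image_stdSimplex,
    Finset.affineCombination_eq_linear_combination _ _ _ hm]
  refine ⟨Function.update (fun j => l j - s * m j) i s, ⟨fun j => ?_, ?_⟩, ?_⟩
  · rcases eq_or_ne j i with rfl | hj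
    · rwa [Function.update_self]
    · rw [Function.update_of_ne hj]
      exact hnonneg j
  · rw [sum_update_of_eq_zero (f := fun j => l j - s * m j) hi, Finset.sum_sub_distrib,
      ← Finset.mul_sum, hl1, hm]
    ring
  · simp only [Fintype.linearCombination_apply]
    have hupdate : ∀ j, Function.update (fun j => l j - s * m j) i s j •
        Function.update t i (∑ k, m k • t k) j =
        Function.update (fun j => (l j - s * m j) • t j) i (s • ∑ k, m k • t k) j := fun j => by
      rcases eq_or_ne j i with rfl | hj
      · simp only [Function.update_self]
      · simp only [Function.update_of_ne hj]
    rw [Finset.sum_congr rfl fun j _ => hupdate j,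
      sum_update_of_eq_zero (f := fun j => (l j - s * m j) • t j) (by rw [hi, zero_smul])]
    simp only [sub_smul, mul_smul, Finset.sum_sub_distrib, ← Finset.smul_sum]
    abel

end Simplex

section Power

open EuclideanGeometry

variable {E : Type*} [NormedAddCommGroup E] [InnerProductSpace ℝ E]

/-- The difference `x ↦ s.power x - s'.power x` of the powers with respect to two spheres. The
quadratic terms cancel, so it is affine; its zero set is the radical hyperplane. -/
noncomputable def powerDiff (s s' : Sphere E) : E →ᵃ[ℝ] ℝ :=
  ((2 : ℝ) • innerₛₗ ℝ (s'.center - s.center)).toAffineMap +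
    AffineMap.const ℝ E (s.power 0 - s'.power 0)

theorem powerDiff_apply (s s' : Sphere E) (x : E) :
    powerDiff s s' x = s.power x - s'.power x := by
  simp only [powerDiff, AffineMap.coe_add, Pi.add_apply, LinearMap.coe_toAffineMap,
    LinearMap.smul_apply, innerₛₗ_apply_apply, AffineMap.const_apply, Sphere.power, dist_eq_norm,
    @norm_sub_sq_real E, inner_sub_right, inner_zero_left, norm_zero, real_inner_comm x,
    smul_eq_mul]
  ring

theorem powerDiff_sub_powerDiff (s s' : Sphere E) (x y : E) :
    powerDiff s s' x - powerDiff s s' y = 2 * inner ℝ (s'.center - s.center) (x - y) := by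
  simp only [powerDiff, AffineMap.coe_add, Pi.add_apply, LinearMap.coe_toAffineMap,
    LinearMap.smul_apply, innerₛₗ_apply_apply, AffineMap.const_apply, inner_sub_right, smul_eq_mul]
  ring

-- `s` and `s'` compare in opposite ways on `F` and at `q`, so the radical hyperplane separates `F`
-- from `q` and hence, as `segment ℝ p q` meets `convexHull ℝ F`, also `p` from `q`.
theorem inner_center_sub_center_lt_of_segment_inter_nonempty {s s' : Sphere E} {F : Set E}
    {p q z : E} (hF : ∀ a ∈ F, s.power a < s'.power a) (hq : s'.power q ≤ s.power q)
    (hpq : (segment ℝ p q ∩ convexHull ℝ F).Nonempty) (hz : s'.power z ≤ s.power z) :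
    inner ℝ (s.center - s'.center) z < inner ℝ (s.center - s'.center) p := by
  have hpos : convexHull ℝ F ⊆ powerDiff s' s ⁻¹' Set.Ioi 0 :=
    convexHull_min (fun a ha => by simpa [powerDiff_apply] using hF a ha)
      ((convex_Ioi 0).affine_preimage _)
  have hp : 0 < powerDiff s' s p := by
    by_contra! hp
    obtain ⟨y, hyseg, hyF⟩ := hpq
    have hle : powerDiff s' s y ≤ 0 :=
      ((convex_Iic 0).affine_preimage (powerDiff s' s)).segment_subset hp
        (by simpa [powerDiff_apply] using hq) hyseg
    exact (Set.mem_Ioi.1 (hpos hyF)).not_ge hle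
  have hdiff := powerDiff_sub_powerDiff s' s p z
  rw [inner_sub_right, powerDiff_apply _ _ z] at hdiff
  linarith

theorem power_circumsphere_point {n : ℕ} (T : Affine.Simplex ℝ E n) (i : Fin (n + 1)) :
    T.circumsphere.power (T.points i) = 0 :=
  (Sphere.power_eq_zero_iff_mem_sphere T.circumradius_nonneg).2 (T.mem_circumsphere i)

end Power

section Genericity

/-- The genericity condition on `x` that makes the local improvement of simplices work: `x` lies in
no proper affine subspace that is spanned by points of `P`. -/
def AvoidsProperAffineSpans (𝕜 : Type*) {E : Type*} [Ring 𝕜] [AddCommGroup E] [Module 𝕜 E]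
    (P : Set E) (x : E) : Prop :=
  ∀ S ⊆ P, x ∈ affineSpan 𝕜 S → affineSpan 𝕜 S = ⊤

theorem dense_setOf_avoidsProperAffineSpans {E : Type*} [NormedAddCommGroup E] [NormedSpace ℝ E]
    [FiniteDimensional ℝ E] {P : Set E} (hP : P.Finite) :
    Dense {x | AvoidsProperAffineSpans ℝ P x} := by
  borelize E
  refine MeasureTheory.Measure.dense_of_ae (μ := MeasureTheory.Measure.addHaar) ?_
  have hae : ∀ S ∈ 𝒫 P, ∀ᵐ x ∂(MeasureTheory.Measure.addHaar : MeasureTheory.Measure E),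
      x ∈ affineSpan ℝ S → affineSpan ℝ S = ⊤ := fun S _ => by
    by_cases hS : affineSpan ℝ S = ⊤
    · exact Filter.Eventually.of_forall fun _ _ => hS
    · filter_upwards [MeasureTheory.measure_eq_zero_iff_ae_notMem.1
        (MeasureTheory.Measure.addHaar_affineSubspace _ _ hS)] with x hx hxS
      exact absurd hxS hx
  exact (MeasureTheory.ae_ball_iff hP.finite_subsets.countable).2 hae

theorem AvoidsProperAffineSpans.affineIndependent {𝕜 E ι : Type*} [DivisionRing 𝕜]
    [AddCommGroup E] [Module 𝕜 E] [Fintype ι] {P : Set E} {x : E}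
    (hx : AvoidsProperAffineSpans 𝕜 P x) (hι : Fintype.card ι = Module.finrank 𝕜 E + 1) {t : ι → E}
    (ht : ∀ i, t i ∈ P) (hxt : x ∈ affineSpan 𝕜 (Set.range t)) : AffineIndependent 𝕜 t := by
  rw [affineIndependent_iff_finrank_vectorSpan_eq 𝕜 t hι,
    AffineSubspace.vectorSpan_eq_top_of_affineSpan_eq_top 𝕜 _ _
      (hx _ (Set.range_subset_iff.2 ht) hxt), finrank_top]

section OrderedField

variable {𝕜 E : Type*} [Field 𝕜] [LinearOrder 𝕜] [IsStrictOrderedRing 𝕜] [AddCommGroup E]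
  [Module 𝕜 E] {n : ℕ} {P : Set E} {x : E}

theorem AvoidsProperAffineSpans.mem_interior [NeZero n]
    (hx : AvoidsProperAffineSpans 𝕜 P x) {T : Affine.Simplex 𝕜 E n} (hT : ∀ k, T.points k ∈ P)
    (hxT : x ∈ T.closedInterior) : x ∈ T.interior := by
  rw [T.closedInterior_eq_interior_union] at hxT
  refine hxT.resolve_right fun hface => ?_
  obtain ⟨i, hi⟩ := Set.mem_iUnion.1 hface
  have hsub : Set.range (T.faceOpposite i).points ⊆ P := by
    rw [T.range_faceOpposite_points]
    exact Set.image_subset_iff.2 fun k _ => hT k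
  have htop := hx _ hsub (Affine.Simplex.closedInterior_subset_affineSpan hi)
  exact T.points_notMem_affineSpan_faceOpposite i (htop ▸ AffineSubspace.mem_top 𝕜 E _)

theorem AvoidsProperAffineSpans.exists_simplex [FiniteDimensional 𝕜 E]
    (hn : Module.finrank 𝕜 E = n) (hx : AvoidsProperAffineSpans 𝕜 P x) (hxP : x ∈ convexHull 𝕜 P) :
    ∃ T : Affine.Simplex 𝕜 E n, (∀ k, T.points k ∈ P) ∧ x ∈ T.closedInterior := by
  rw [convexHull_eq_union] at hxP
  simp only [Set.mem_iUnion, exists_prop] at hxP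
  obtain ⟨t, htP, hindep, hxt⟩ := hxP
  have htop : affineSpan 𝕜 (Set.range ((↑) : t → E)) = ⊤ :=
    hx _ (by rwa [Subtype.range_coe]) (by
      rw [Subtype.range_coe]; exact convexHull_subset_affineSpan _ hxt)
  rw [hindep.affineSpan_eq_top_iff_card_eq_finrank_add_one, hn] at htop
  let e : Fin (n + 1) ≃ t := (Fintype.equivFinOfCardEq htop).symm
  refine ⟨⟨fun k => e k, hindep.comp_embedding e.toEmbedding⟩, fun k => htP (e k).2, ?_⟩
  rw [← Affine.Simplex.convexHull_eq_closedInterior]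
  have hrange : Set.range (fun k => (e k : E)) = t := by
    rw [← Function.comp_def, e.surjective.range_comp, Subtype.range_coe]
  simpa only [hrange] using hxt

end OrderedField

theorem AvoidsProperAffineSpans.exists_simplex_power_lt {E : Type*} [NormedAddCommGroup E]
    [InnerProductSpace ℝ E] [FiniteDimensional ℝ E] {n : ℕ} [NeZero n]
    (hn : Module.finrank ℝ E = n) {P : Set E} {x : E}
    (hx : AvoidsProperAffineSpans ℝ P x) {T : Affine.Simplex ℝ E n} (hT : ∀ k, T.points k ∈ P)
    (hxT : x ∈ T.closedInterior) {q : E} (hqP : q ∈ P) (hq : T.circumsphere.power q < 0) :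
    ∃ T' : Affine.Simplex ℝ E n, (∀ k, T'.points k ∈ P) ∧ x ∈ T'.closedInterior ∧
      T.circumsphere.power x < T'.circumsphere.power x := by
  have hspan : affineSpan ℝ (Set.range T.points) = ⊤ := by
    rw [T.independent.affineSpan_eq_top_iff_card_eq_finrank_add_one, hn, Fintype.card_fin]
  rw [← T.convexHull_eq_closedInterior] at hxT
  obtain ⟨i, hi⟩ := exists_mem_convexHull_range_update hxT (hspan ▸ AffineSubspace.mem_top ℝ E q)
  set t := Function.update T.points i q with ht
  have htP : ∀ k, t k ∈ P := fun k => by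
    rcases eq_or_ne k i with rfl | hk
    · rwa [ht, Function.update_self]
    · rw [ht, Function.update_of_ne hk]
      exact hT k
  let T' : Affine.Simplex ℝ E n :=
    ⟨t, hx.affineIndependent (by rw [hn, Fintype.card_fin]) htP
      (convexHull_subset_affineSpan _ hi)⟩
  have hxT' : x ∈ T'.closedInterior := T'.convexHull_eq_closedInterior ▸ hi
  refine ⟨T', htP, hxT', ?_⟩
  have hi_q : T'.points i = q := Function.update_self ..
  have hpos : 0 < powerDiff T'.circumsphere T.circumsphere (T'.points i) := by
    rw [powerDiff_apply, power_circumsphere_point, hi_q]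
    linarith
  have hnonneg : ∀ k, 0 ≤ powerDiff T'.circumsphere T.circumsphere (T'.points k) := fun k => by
    rcases eq_or_ne k i with rfl | hk
    · exact hpos.le
    · have hk_T : T'.points k = T.points k := Function.update_of_ne hk ..
      rw [powerDiff_apply, power_circumsphere_point, hk_T, power_circumsphere_point, sub_zero]
  have := pos_of_mem_simplex_interior (hx.mem_interior htP hxT') hnonneg hpos
  rwa [powerDiff_apply, sub_pos] at this

end Genericity

section Delaunay

variable {E : Type*} [NormedAddCommGroup E] [InnerProductSpace ℝ E] {n : ℕ} {P : Set E}

/-- `T` is a Delaunay simplex of `P`: its vertices are in `P`, and no point of `P` is in the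
interior of its circumsphere, i.e. has negative power. -/
def IsDelaunaySimplex (P : Set E) (T : Affine.Simplex ℝ E n) : Prop :=
  (∀ k, T.points k ∈ P) ∧ ∀ q ∈ P, 0 ≤ T.circumsphere.power q

theorem IsDelaunaySimplex.notMem_interior [NeZero n] {T : Affine.Simplex ℝ E n}
    (hT : IsDelaunaySimplex P T) {q : E} (hq : q ∈ P) : q ∉ T.interior := fun hqT => by
  have hradius := (EuclideanGeometry.Sphere.power_nonneg_iff_radius_le_dist_center
    T.circumradius_nonneg).1 (hT.2 q hq)
  refine hradius.not_gt (T.dist_lt_of_mem_interior_of_strictConvexSpace hqT fun i => ?_)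
  exact (T.dist_circumcenter_eq_circumradius i).le

variable [FiniteDimensional ℝ E] [NeZero n]

theorem AvoidsProperAffineSpans.exists_isDelaunaySimplex {x : E}
    (hx : AvoidsProperAffineSpans ℝ P x) (hn : Module.finrank ℝ E = n) (hP : P.Finite)
    (hxP : x ∈ convexHull ℝ P) :
    ∃ T : Affine.Simplex ℝ E n, IsDelaunaySimplex P T ∧ x ∈ T.closedInterior := by
  have hfin : {T : Affine.Simplex ℝ E n |
      (∀ k, T.points k ∈ P) ∧ x ∈ T.closedInterior}.Finite :=
    (finite_setOf_simplex_points_mem hP).subset fun _ hT => hT.1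
  obtain ⟨T, ⟨hT, hxT⟩, hmax⟩ := Set.exists_max_image _ (fun T => T.circumsphere.power x) hfin
    (hx.exists_simplex hn hxP)
  refine ⟨T, ⟨hT, fun q hq => ?_⟩, hxT⟩
  by_contra! hneg
  obtain ⟨T', hT', hxT', hlt⟩ := hx.exists_simplex_power_lt hn hT hxT hq hneg
  exact (hmax T' ⟨hT', hxT'⟩).not_gt hlt

theorem exists_isDelaunaySimplex (hn : Module.finrank ℝ E = n) (hP : P.Finite)
    (hspan : affineSpan ℝ P = ⊤) {p : E} (hp : p ∈ convexHull ℝ P) :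
    ∃ T : Affine.Simplex ℝ E n, IsDelaunaySimplex P T ∧ p ∈ T.closedInterior := by
  have hne : (interior (convexHull ℝ P)).Nonempty :=
    interior_convexHull_nonempty_iff_affineSpan_eq_top.2 hspan
  have hclosed : IsClosed
      (⋃ T ∈ {T : Affine.Simplex ℝ E n | IsDelaunaySimplex P T}, T.closedInterior) :=
    ((finite_setOf_simplex_points_mem hP).subset fun _ hT => hT.1).isClosed_biUnion
      fun T _ => T.isClosed_closedInterior
  have hgeneric : interior (convexHull ℝ P) ∩ {x | AvoidsProperAffineSpans ℝ P x} ⊆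
      ⋃ T ∈ {T : Affine.Simplex ℝ E n | IsDelaunaySimplex P T}, T.closedInterior := by
    rintro x ⟨hxP, hx⟩
    obtain ⟨T, hT, hxT⟩ :=
      AvoidsProperAffineSpans.exists_isDelaunaySimplex hx hn hP (interior_subset hxP)
    exact Set.mem_iUnion₂.2 ⟨T, hT, hxT⟩
  have hmem : p ∈ closure (interior (convexHull ℝ P)) := by
    rw [(convex_convexHull ℝ P).closure_interior_eq_closure_of_nonempty_interior hne]
    exact subset_closure hp
  have hdense := (dense_setOf_avoidsProperAffineSpans hP).open_subset_closure_inter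
    (isOpen_interior (s := convexHull ℝ P))
  obtain ⟨T, hT, hpT⟩ := Set.mem_iUnion₂.1 (closure_minimal (hdense.trans
    (closure_minimal hgeneric hclosed)) hclosed hmem)
  exact ⟨T, hT, hpT⟩

end Delaunay

section Triangle

theorem closedInterior_faceOpposite_triangle {𝕜 E : Type*} [Field 𝕜] [LinearOrder 𝕜]
    [IsStrictOrderedRing 𝕜] [AddCommGroup E] [Module 𝕜 E] (T : Affine.Triangle 𝕜 E) (k : Fin 3) :
    (T.faceOpposite k).closedInterior = segment 𝕜 (T.points (k + 1)) (T.points (k + 2)) := by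
  have hcompl : ({k}ᶜ : Set (Fin 3)) = {k + 1, k + 2} := by
    ext j
    simp only [Set.mem_compl_iff, Set.mem_singleton_iff, Set.mem_insert_iff]
    revert j k
    decide
  rw [← Affine.Simplex.convexHull_eq_closedInterior, Affine.Simplex.range_faceOpposite_points,
    hcompl, Set.image_pair, convexHull_pair]

theorem nonempty_of_not_collinear {k V A : Type*} [DivisionRing k] [AddCommGroup V]
    [Module k V] [AddTorsor V A] {S : Set A} (hS : ¬ Collinear k S) : S.Nonempty :=
  Set.nonempty_iff_ne_empty.2 fun hempty => hS (hempty ▸ collinear_empty k A)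

theorem affineSpan_eq_top_of_not_collinear {k V A : Type*} [DivisionRing k] [AddCommGroup V]
    [Module k V] [AddTorsor V A] (hV : Module.finrank k V = 2) {S : Set A}
    (hS : ¬ Collinear k S) : affineSpan k S = ⊤ := by
  have : FiniteDimensional k V := Module.finite_of_finrank_pos (by omega)
  rw [AffineSubspace.affineSpan_eq_top_iff_vectorSpan_eq_top_of_nonempty k _ _
    (nonempty_of_not_collinear hS)]
  rw [collinear_iff_finrank_le_one] at hS
  exact Submodule.eq_top_of_finrank_eq
    (le_antisymm (Submodule.finrank_le _) (by omega))

variable {P : Finset Plane} {T : Affine.Triangle ℝ Plane} {p : Plane} {i j : Fin 3}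

theorem isDelaunayTriangle_iff : IsDelaunayTriangle P T ↔ IsDelaunaySimplex (P : Set Plane) T :=
  and_congr Iff.rfl <| forall₂_congr fun _ _ =>
    (EuclideanGeometry.Sphere.power_nonneg_iff_radius_le_dist_center T.circumradius_nonneg).symm

theorem exists_isDelaunayTriangle (hP : ¬ Collinear ℝ (P : Set Plane))
    (hp : p ∈ convexHull ℝ (P : Set Plane)) :
    ∃ T : Affine.Triangle ℝ Plane, IsDelaunayTriangle P T ∧
      p ∈ convexHull ℝ (Set.range T.points) := by
  have hdim : Module.finrank ℝ Plane = 2 := finrank_euclideanSpace_fin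
  obtain ⟨T, hT, hpT⟩ := exists_isDelaunaySimplex hdim P.finite_toSet
    (affineSpan_eq_top_of_not_collinear hdim hP) hp
  exact ⟨T, isDelaunayTriangle_iff.2 hT, T.convexHull_eq_closedInterior ▸ hpT⟩

theorem crossingPoints_subset : crossingPoints P T p i j ⊆ P := fun _ hq => hq.1

theorem IsDelaunayTriangle.subset_range_points_union_crossingPoints (hT : IsDelaunayTriangle P T)
    (hp : p ∈ convexHull ℝ (Set.range T.points)) :
    (P : Set Plane) ⊆
      Set.range T.points ∪ ⋃ k : Fin 3, crossingPoints P T p (k + 1) (k + 2) := by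
  intro q hq
  by_cases hqT : q ∈ Set.range T.points
  · exact Or.inl hqT
  · obtain ⟨k, hk⟩ := exists_segment_inter_faceOpposite_nonempty finrank_euclideanSpace_fin
      (T.convexHull_eq_closedInterior ▸ hp) ((isDelaunayTriangle_iff.1 hT).notMem_interior hq)
    rw [closedInterior_faceOpposite_triangle] at hk
    exact Or.inr (Set.mem_iUnion.2 ⟨k, hq, hqT, hk⟩)

theorem IsDelaunayTriangle.card_sub_three_le_sum_ncard_crossingPoints
    (hT : IsDelaunayTriangle P T) (hp : p ∈ convexHull ℝ (Set.range T.points)) :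
    (P.card : ℝ) - 3 ≤ ∑ k : Fin 3, ((crossingPoints P T p (k + 1) (k + 2)).ncard : ℝ) := by
  have hvertices : (Set.range T.points).ncard = 3 := by
    rw [← Nat.card_coe_set_eq, Nat.card_range_of_injective T.independent.injective, Nat.card_fin]
  have hcrossing := Finset.set_ncard_biUnion_le Finset.univ
    fun k : Fin 3 => crossingPoints P T p (k + 1) (k + 2)
  simp only [Finset.mem_univ, Set.iUnion_true] at hcrossing
  have hcard := (Set.ncard_le_ncard (hT.subset_range_points_union_crossingPoints hp)
    ((Set.finite_range _).union (Set.finite_iUnion fun _ =>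
      P.finite_toSet.subset crossingPoints_subset))).trans (Set.ncard_union_le _ _)
  rw [Set.ncard_coe_finset, hvertices] at hcard
  rw [sub_le_iff_le_add']
  exact_mod_cast hcard.trans (Nat.add_le_add_left hcrossing 3)

theorem IsDelaunayTriangle.exists_le_ncard_crossingPoints (hT : IsDelaunayTriangle P T)
    (hp : p ∈ convexHull ℝ (Set.range T.points)) :
    ∃ i j : Fin 3, i ≠ j ∧
      ((P.card : ℝ) - 3) / 3 ≤ ((crossingPoints P T p i j).ncard : ℝ) := by
  obtain ⟨k, -, hk⟩ := Finset.exists_le_of_sum_le (s := (Finset.univ : Finset (Fin 3)))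
    (f := fun _ => ((P.card : ℝ) - 3) / 3) Finset.univ_nonempty
    (by simpa [mul_div_cancel₀] using hT.card_sub_three_le_sum_ncard_crossingPoints hp)
  exact ⟨k + 1, k + 2, by simp, hk⟩

theorem IsDelaunayTriangle.ncard_inter_closedBall_add_le_of_crossingPoints_mem
    (hT : IsDelaunayTriangle P T) (hp : IsCenterpoint P p) {o q : Plane} {r : ℝ} (hr : 0 ≤ r)
    (hi : T.points i ∉ Metric.closedBall o r) (hj : T.points j ∉ Metric.closedBall o r)
    (hq : q ∈ crossingPoints P T p i j) (hqD : q ∈ Metric.closedBall o r) :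
    ((Metric.closedBall o r ∩ P).ncard : ℝ) + (P.card : ℝ) / 3 ≤ P.card := by
  let s : EuclideanGeometry.Sphere Plane := ⟨o, r⟩
  have hpower : ∀ z ∈ P, z ∈ Metric.closedBall o r → s.power z ≤ T.circumsphere.power z :=
    fun z hz hzD => ((EuclideanGeometry.Sphere.power_nonpos_iff_dist_center_le_radius
      (s := s) hr).2 hzD).trans ((isDelaunayTriangle_iff.1 hT).2 z hz)
  have hvertex : ∀ k, T.points k ∉ Metric.closedBall o r →
      T.circumsphere.power (T.points k) < s.power (T.points k) := fun k hk => by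
    rw [power_circumsphere_point, EuclideanGeometry.Sphere.power_pos_iff_radius_lt_dist_center hr]
    exact not_le.1 hk
  have hedge : ∀ a ∈ ({T.points i, T.points j} : Set Plane),
      T.circumsphere.power a < s.power a := by
    rintro _ (rfl | rfl)
    exacts [hvertex i hi, hvertex j hj]
  have hsep : ∀ z ∈ P, z ∈ Metric.closedBall o r →
      inner ℝ (T.circumcenter - o) z < inner ℝ (T.circumcenter - o) p := fun z hz hzD =>
    inner_center_sub_center_lt_of_segment_inter_nonempty hedge (hpower q hq.1 hqD)
      (convexHull_pair (𝕜 := ℝ) (T.points i) (T.points j) ▸ hq.2.2) (hpower z hz hzD)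
  convert hp.ncard_inter_add_le hsep using 3
  norm_num

theorem ncard_crossingPoints_union_vertices (hij : i ≠ j) :
    (crossingPoints P T p i j ∪ {T.points i, T.points j}).ncard =
      (crossingPoints P T p i j).ncard + 2 := by
  have hdisj : Disjoint (crossingPoints P T p i j) {T.points i, T.points j} := by
    rw [Set.disjoint_left]
    rintro _ hq (rfl | rfl)
    exacts [hq.2.1 ⟨i, rfl⟩, hq.2.1 ⟨j, rfl⟩]
  rw [Set.ncard_union_eq hdisj (P.finite_toSet.subset crossingPoints_subset),
    Set.ncard_pair (T.independent.injective.ne hij)]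

theorem IsDelaunayTriangle.isStrongNet (hT : IsDelaunayTriangle P T) (hp : IsCenterpoint P p)
    (hij : i ≠ j)
    (hcrossing : ((P.card : ℝ) - 3) / 3 ≤ ((crossingPoints P T p i j).ncard : ℝ)) :
    IsStrongNet (2 / 3) P disks {T.points i, T.points j} := by
  have hsub : ({T.points i, T.points j} : Set Plane) ⊆ P :=
    Set.pair_subset (hT.1 i) (hT.1 j)
  refine ⟨hsub, ?_⟩
  rintro _ ⟨o, r, hr, rfl⟩ hD
  by_contra hempty
  have hi : T.points i ∉ Metric.closedBall o r := fun h => hempty ⟨_, Or.inl rfl, h⟩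
  have hj : T.points j ∉ Metric.closedBall o r := fun h => hempty ⟨_, Or.inr rfl, h⟩
  by_cases hmeets : ∃ q ∈ crossingPoints P T p i j, q ∈ Metric.closedBall o r
  · obtain ⟨q, hq, hqD⟩ := hmeets
    have := hT.ncard_inter_closedBall_add_le_of_crossingPoints_mem hp hr.le hi hj hq hqD
    linarith
  · push Not at hmeets
    have hdisj : Disjoint (crossingPoints P T p i j ∪ {T.points i, T.points j})
        (Metric.closedBall o r) := by
      rw [Set.disjoint_left]
      rintro z (hz | rfl | rfl)
      exacts [hmeets z hz, hi, hj]
    have hcount := ncard_add_ncard_inter_le (Set.union_subset crossingPoints_subset hsub) hdisj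
    rw [ncard_crossingPoints_union_vertices hij] at hcount
    have : ((crossingPoints P T p i j).ncard : ℝ) + 2 +
      ((Metric.closedBall o r ∩ P).ncard : ℝ) ≤ P.card := mod_cast hcount
    linarith

end Triangle

section Median

variable {α : Type*} {P : Finset α}

theorem IsStrongNet.mono {ε ε' : ℝ} {𝓡 𝓡' : Set (Set α)} {N N' : Set α}
    (hN : IsStrongNet ε P 𝓡 N) (hε : ε ≤ ε') (h𝓡 : 𝓡' ⊆ 𝓡) (hNN' : N ⊆ N') (hN' : N' ⊆ P) :
    IsStrongNet ε' P 𝓡' N' :=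
  ⟨hN', fun R hR hlt => (hN.2 R (h𝓡 hR)
    ((mul_le_mul_of_nonneg_right hε (Nat.cast_nonneg _)).trans_lt hlt)).mono
      (Set.inter_subset_inter_left R hNN')⟩

theorem exists_median {β : Type*} [LinearOrder β] (hP : P.Nonempty) (f : α → β) :
    ∃ m ∈ P, 2 * (P.filter fun q => f q < f m).card ≤ P.card ∧
      2 * (P.filter fun q => f m < f q).card ≤ P.card := by
  classical
  have hne : (P.filter fun m => 2 * (P.filter fun q => f q < f m).card ≤ P.card).Nonempty := by
    obtain ⟨m, hm, hmin⟩ := Finset.exists_min_image P f hP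
    refine ⟨m, Finset.mem_filter.2 ⟨hm, ?_⟩⟩
    rw [Finset.filter_false_of_mem fun q hq => (hmin q hq).not_gt]
    exact Nat.zero_le _
  obtain ⟨m, hm, hmax⟩ := Finset.exists_max_image _ f hne
  obtain ⟨hmP, hbelow⟩ := Finset.mem_filter.1 hm
  refine ⟨m, hmP, hbelow, ?_⟩
  by_contra! habove
  have hne' : (P.filter fun q => f m < f q).Nonempty := Finset.card_pos.1 (by omega)
  obtain ⟨m', hm', hmin⟩ := Finset.exists_min_image _ f hne'
  obtain ⟨hm'P, hlt⟩ := Finset.mem_filter.1 hm'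
  have hle : (P.filter fun q => f q < f m').card ≤ (P.filter fun q => ¬ f m < f q).card :=
    Finset.card_le_card fun q hq => Finset.mem_filter.2 ⟨(Finset.mem_filter.1 hq).1, fun h =>
      (hmin q (Finset.mem_filter.2 ⟨(Finset.mem_filter.1 hq).1, h⟩)).not_gt
        (Finset.mem_filter.1 hq).2⟩
  have hsum := Finset.card_filter_add_card_filter_not (s := P) (fun q => f m < f q)
  exact (hmax m' (Finset.mem_filter.2 ⟨hm'P, by omega⟩)).not_gt hlt

theorem exists_isStrongNet_half_ordConnected {β : Type*} [LinearOrder β] (hP : P.Nonempty)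
    (f : α → β) :
    ∃ m ∈ P, IsStrongNet (1 / 2) P
      {C | ∃ I : Set β, I.OrdConnected ∧ ∀ q ∈ P, q ∈ C ↔ f q ∈ I} {m} := by
  classical
  obtain ⟨m, hmP, hbelow, habove⟩ := exists_median hP f
  refine ⟨m, hmP, Set.singleton_subset_iff.2 hmP, ?_⟩
  rintro C ⟨I, hI, hC⟩ hlt
  have hnot : ∀ B : Finset α, 2 * B.card ≤ P.card → ¬ C ∩ (P : Set α) ⊆ B := fun B hB hsub => by
    have hle := Set.ncard_le_ncard hsub B.finite_toSet
    rw [Set.ncard_coe_finset] at hle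
    have : 2 * ((C ∩ (P : Set α)).ncard : ℝ) ≤ P.card :=
      mod_cast (Nat.mul_le_mul_left 2 hle).trans hB
    linarith
  obtain ⟨b, ⟨hbC, hbP⟩, hb⟩ := Set.not_subset.1 (hnot _ hbelow)
  obtain ⟨a, ⟨haC, haP⟩, ha⟩ := Set.not_subset.1 (hnot _ habove)
  have ham : f a ≤ f m := not_lt.1 fun h => ha (Finset.mem_filter.2 ⟨haP, h⟩)
  have hmb : f m ≤ f b := not_lt.1 fun h => hb (Finset.mem_filter.2 ⟨hbP, h⟩)
  exact ⟨m, rfl, (hC m hmP).2 (hI.out ((hC a haP).1 haC) ((hC b hbP).1 hbC) ⟨ham, hmb⟩)⟩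

theorem exists_isStrongNet_half_convex_of_collinear {𝕜 E : Type*} [Field 𝕜] [LinearOrder 𝕜]
    [IsStrictOrderedRing 𝕜] [AddCommGroup E] [Module 𝕜 E] {P : Finset E} (hP : P.Nonempty)
    (hcol : Collinear 𝕜 (P : Set E)) :
    ∃ m ∈ P, IsStrongNet (1 / 2) P {C | Convex 𝕜 C} {m} := by
  obtain ⟨p₀, v, hv⟩ := (collinear_iff_exists_forall_eq_smul_vadd (k := 𝕜) _).1 hcol
  choose! f hf using hv
  obtain ⟨m, hmP, hm⟩ := exists_isStrongNet_half_ordConnected hP f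
  refine ⟨m, hmP, hm.mono le_rfl (fun C hC => ?_) subset_rfl hm.1⟩
  refine ⟨_, (hC.affine_preimage (AffineMap.lineMap p₀ (v +ᵥ p₀))).ordConnected, fun q hq => ?_⟩
  rw [Set.mem_preimage, AffineMap.lineMap_apply, vadd_vsub, ← hf q hq]

end Median

theorem two_thirds_mem_netBounds_disks : (2 / 3 : ℝ) ∈ netBounds disks 2 := by
  classical
  refine ⟨by norm_num, fun P hcard => ?_⟩
  have hne : P.Nonempty := Finset.card_pos.1 (by omega)
  by_cases hP : Collinear ℝ (P : Set Plane)
  · obtain ⟨m, hmP, hm⟩ := exists_isStrongNet_half_convex_of_collinear hne hP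
    obtain ⟨Q, hmQ, hQP, hQ⟩ := Finset.exists_subsuperset_card_eq
      (Finset.singleton_subset_iff.2 hmP) (by simp) hcard
    refine ⟨Q, hQP, hQ, hm.mono (by norm_num) ?_ (by simpa using hmQ) (by exact_mod_cast hQP)⟩
    rintro _ ⟨o, r, -, rfl⟩
    exact convex_closedBall o r
  · obtain ⟨p, hp⟩ := exists_isCenterpoint hne
    obtain ⟨T, hT, hpT⟩ := exists_isDelaunayTriangle hP (hp.mem_convexHull hne)
    obtain ⟨i, j, hij, hcrossing⟩ := hT.exists_le_ncard_crossingPoints hpT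
    have hnet := hT.isStrongNet hp hij hcrossing
    rw [← Finset.coe_pair] at hnet
    exact ⟨{T.points i, T.points j}, mod_cast hnet.1,
      Finset.card_pair (T.independent.injective.ne hij), hnet⟩

theorem mainTheorem7 :
    epsilonConst disks 2 ≤ 2 / 3 ∧
    ∀ P : Finset Plane, ¬ Collinear ℝ (P : Set Plane) →
      (∃ p : Plane, IsCenterpoint P p) ∧
      ∀ p : Plane, IsCenterpoint P p →
        (∃ T : Affine.Triangle ℝ Plane, IsDelaunayTriangle P T ∧
          p ∈ convexHull ℝ (Set.range T.points)) ∧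
        ∀ T : Affine.Triangle ℝ Plane, IsDelaunayTriangle P T →
          p ∈ convexHull ℝ (Set.range T.points) →
          (∃ i j : Fin 3, i ≠ j ∧
            ((P.card : ℝ) - 3) / 3 ≤ ((crossingPoints P T p i j).ncard : ℝ)) ∧
          ∀ i j : Fin 3, i ≠ j →
            ((P.card : ℝ) - 3) / 3 ≤ ((crossingPoints P T p i j).ncard : ℝ) →
            IsStrongNet (2 / 3) P disks {T.points i, T.points j} := by
  refine ⟨(isLeast_epsilonConst disks 2).2 two_thirds_mem_netBounds_disks, fun P hP => ?_⟩
  have hne : P.Nonempty := Finset.coe_nonempty.1 (nonempty_of_not_collinear hP)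
  exact ⟨exists_isCenterpoint hne, fun p hp =>
    ⟨exists_isDelaunayTriangle hP (hp.mem_convexHull hne), fun T hT hpT =>
      ⟨hT.exists_le_ncard_crossingPoints hpT, fun i j => hT.isStrongNet hp⟩⟩⟩
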